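/- Let $X$ be a finite alphabet with at least two letters and let $X^{\omega}$ be the set of infinite words over $X$. An automaton over $X$ consists of a set $S$ of states, a transition function $\lambda\colon S\times X\to S$ and an output function $\pi\colon S\times X\to X$ such that every $\pi(s,\cdot)$ is a permutation of $X$; its Moore diagram is the directed graph with vertex set $S$ that has one arrow $s\to\lambda(s,x)$ for every $s\in S$ and $x\in X$. A state $s$ transforms $X^{\omega}$ by $s(x_1x_2x_3\ldots)=\pi(s_1,x_1)\pi(s_2,x_2)\pi(s_3,x_3)\ldots$, where $s_1=s$ and $s_{i+1}=\lambda(s_i,x_i)$. All automata are assumed to be finite and minimized, i.e. different states define different transformations of $X^\omega$. A cycle is a simple directed cycle of the Moore diagram; it is trivial if it is a loop at a state that acts trivially on $X^{\omega}$. An automaton is polynomial if different nontrivial cycles have no common state, and it has degree $\le m$ if at most $m+1$ different nontrivial cycles are connected by a directed path. For $m\ge -1$ let $\mathrm{Pol}(m)$ be the group of all transformations of $X^{\omega}$ that are states of polynomial automata of degree $\le m$. For a group $G$ of transformations of $X^\omega$ generated by a finite set $T$ and for $w\in X^{\omega}$, the orbital Schreier graph $\Gamma_w(G,T)$ has the orbit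 $G(w)$ as vertex set, and $u,v$ are adjacent if $t(u)=v$ for some $t\in T\cup T^{-1}$. Its growth function $\gamma_v(n)$ with respect to a vertex $v$ is the number of vertices in the closed ball of radius $n$ around $v$. Growth is understood up to rescaling of the argument: $f\prec g$ ($f$ has growth not greater than $g$) if there is a positive integer $D$ such that $f(n)\le g(Dn)$ for all $n\ge 0$; a function has subexponential growth if, for $a>1$, its growth is not greater than that of $a^n$ and not equivalent to it. Logarithms are to the base $2$, with the convention $\log 0=\log 1=1$. Theorem. Let $m\ge -1$ and let $G$ be a finitely generated subgroup of $\mathrm{Pol}(m)$. Then there is a constant $C>0$ such that every orbital Schreier graph $\Gamma_w(G)$, $w\in X^{\omega}$, has subexponential growth not greater than $|X|^{C(\log n)^{m+1}}$. More precisely, for every finite generating set $T$ of $G$ there is a positive integer $D$ such that, for all $w\in X^{\omega}$, all vertices $v$ of $\Gamma_w(G,T)$ and all $n\ge 0$, the closed ball of radius $n$ around $v$ in $\Gamma_w(G,T)$ is finite and $$\gamma_v(n)\le |X|^{C(\log (Dn))^{m+1}},$$ and every such growth function $\gamma_v$ is subexponential. -/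

import Mathlib

/-- An invertible automaton over the alphabet `X` with set of states `S`: a transition function
`trans = λ : S × X → S` and an output function `out = π : S × X → X` such that every `π(s, ·)` is a
permutation of `X`. Its Moore diagram has one arrow `s → λ(s, x)`, identified with the pair
`(s, x)`, for every state `s` and every letter `x`. -/
structure Automaton (S X : Type*) where
  /-- the transition function -/
  trans : S → X → S
  /-- the output function -/
  out : S → Equiv.Perm X

namespace Automaton

variable {S X : Type*} (A : Automaton S X)

/-- The state `s|_v`: the end of the path that starts at `s` and reads the finite word `v`. -/
def sec : S → List X → S
  | s, [] => s
  | s, x :: v => sec (A.trans s x) v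

/-- The arrows of the path that starts at `s` and reads the finite word `v`. -/
def arrows : S → List X → List (S × X)
  | _, [] => []
  | s, x :: v => (s, x) :: arrows (A.trans s x) v

/-- The state reached from `s` after reading the first `n` letters of the infinite word `w`. -/
def stateAt (s : S) (w : ℕ → X) : ℕ → S
  | 0 => s
  | n + 1 => A.trans (stateAt s w n) (w n)

/-- The transformation of the space `X^ω` of infinite words defined by the state `s`. -/
def act (s : S) (w : ℕ → X) : ℕ → X :=
  fun n => A.out (A.stateAt s w n) (w n)

/-- The automaton is minimized: different states act differently on `X^ω`. -/
def IsMinimized : Prop :=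
  Function.Injective A.act

/-- The set of arrows `C` is a cycle, that is, a simple directed cycle of the Moore diagram
(so cycles that pass through the same states along different parallel arrows are different). -/
def IsCycle (C : Set (S × X)) : Prop :=
  ∃ (s : S) (v : List X), v ≠ [] ∧ A.sec s v = s ∧ ((A.arrows s v).map Prod.fst).Nodup ∧
    C = {a | a ∈ A.arrows s v}

/-- The cycle `C` is trivial: a loop at a state that acts trivially on `X^ω`. -/
def IsTrivialCycle (C : Set (S × X)) : Prop :=
  A.IsCycle C ∧ ∃ (s : S) (x : X), C = {(s, x)} ∧ A.act s = id

/-- The cycle `C` is nontrivial. -/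
def IsNontrivialCycle (C : Set (S × X)) : Prop :=
  A.IsCycle C ∧ ¬ A.IsTrivialCycle C

/-- The automaton is polynomial: different nontrivial cycles have no state in common. -/
def IsPolynomial : Prop :=
  ∀ C C' : Set (S × X), A.IsNontrivialCycle C → A.IsNontrivialCycle C' → C ≠ C' →
    Disjoint (Prod.fst '' C) (Prod.fst '' C')

/-- At most `m + 1` different nontrivial cycles are connected by a directed path: for every path
(the one from `s` that reads `v`), at most `m + 1` nontrivial cycles contain a state of the path. -/
def HasDegreeLE (m : ℤ) : Prop :=
  ∀ (s : S) (v : List X) (F : Finset (Set (S × X))),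
    (∀ C ∈ F, A.IsNontrivialCycle C ∧ ∃ u : List X, u <+: v ∧ A.sec s u ∈ Prod.fst '' C) →
      (F.card : ℤ) ≤ m + 1

end Automaton

/-- `Pol m`: the set of the transformations of `X^ω` that are states of (finite, minimized)
polynomial automata of degree at most `m`. -/
def Pol (X : Type*) (m : ℤ) : Set (Equiv.Perm (ℕ → X)) :=
  {g | ∃ (S : Type) (_ : Finite S) (A : Automaton S X),
    A.IsMinimized ∧ A.IsPolynomial ∧ A.HasDegreeLE m ∧ ∃ s : S, A.act s = ⇑g}

/-- The orbital Schreier graph `Γ_w(G, T)`: its vertices are the points of the orbit `G(w)`, and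
(different) vertices `u`, `v` are adjacent if `t(u) = v` for some `t ∈ T ∪ T⁻¹`. -/
def orbitalSchreierGraph {X : Type*} (G : Subgroup (Equiv.Perm (ℕ → X)))
    (T : Set (Equiv.Perm (ℕ → X))) (w : ℕ → X) : SimpleGraph (MulAction.orbit G w) where
  Adj u v := u ≠ v ∧ ∃ t : Equiv.Perm (ℕ → X), (t ∈ T ∨ t⁻¹ ∈ T) ∧ t (u : ℕ → X) = v
  symm := ⟨by
    rintro u v ⟨huv, t, ht, h⟩
    exact ⟨huv.symm, t⁻¹, by simpa using ht.symm, by simp [← h]⟩⟩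
  loopless := ⟨fun _ h => h.1 rfl⟩

/-- The closed ball of radius `n` around the vertex `v` of a graph. -/
def graphBall {V : Type*} (Γ : SimpleGraph V) (v : V) (n : ℕ) : Set V :=
  {u | Γ.edist v u ≤ n}

/-- The growth function of a (locally finite) graph with respect to the vertex `v`. -/
noncomputable def growthFun {V : Type*} (Γ : SimpleGraph V) (v : V) (n : ℕ) : ℕ :=
  (graphBall Γ v n).ncard

/-- `f` has growth not greater than `g`. -/
def GrowthLE (f g : ℕ → ℝ) : Prop :=
  ∃ D : ℕ, 0 < D ∧ ∀ n : ℕ, f n ≤ g (D * n)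

/-- Subexponential growth: not greater than the exponential growth, and not equivalent to it
(the growth of `a ^ n` is the same for all `a > 1`). -/
def IsSubexponential (f : ℕ → ℝ) : Prop :=
  ∀ a : ℝ, 1 < a → GrowthLE f (fun n => a ^ n) ∧
    ¬ (GrowthLE f (fun n => a ^ n) ∧ GrowthLE (fun n => a ^ n) f)

/-- The logarithm with base `2`, with the convention `log 0 = log 1 = 1`. -/
noncomputable def logTwo (n : ℕ) : ℝ :=
  if n ≤ 1 then 1 else Real.logb 2 n

/-!
# Schreier graphs of polynomial automata

A product of `n` generators is a row of `n` states, and it reads an infinite word `w` level by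
level: every letter of `w` passes through the row, is changed by each of its members in turn, and
moves each member to its next state. The proof bounds the number of levels at which the row changes.

Reading the letters in blocks, with a block length divisible by the lengths of all cycles, turns the
nontrivial cycles into loops (`isGraded_blockSum`). A state of degree `r + 1` then soon has a loop,
is fixed by exactly one letter, and drops to degree at most `r` at any other letter. Group the
states of degree `r + 1` of a row into rigid blocks, which are fixed by one letter and dissolve
altogether at any other letter. Suppose that every row of at most `n` states of degree at most `r`
changes at most `K` times. If two neighbouring blocks survive for `K` levels, then the row between
them has read a constant word for all that time, so it is fixed from then on; and then the two blocks
either form one rigid block or cannot both survive the next level (`HasBlocks.merge`). So the number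
of blocks is halved every `K + 1` levels, and induction on the degree shows that the row changes at
most `2 (⌈log₂ n⌉ + 3) ^ (m + 1)` times (`IsGraded.changesLE`). Since the number of states in the row
never grows, no contraction of the group is needed.

While the row is fixed and reads a constant word, its output is constant. When the letter of `w`
changes, which happens at a level that does not depend on the row, the row changes as well, unless
it is trivial (`IsGraded.row_trivial`). Hence the image of `w` is encoded by
boundedly many letters for each change (`IsGraded.exists_finset_act`). The constant `C` comes from
one generating set; passing to another one multiplies the lengths of words by a constant, which goes
into `D`.
-/

/-! ### Rows of states and the number of their changes -/

namespace Automaton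

section Sections

variable {S X : Type*} (A : Automaton S X)

theorem sec_append (s : S) (u v : List X) : A.sec s (u ++ v) = A.sec (A.sec s u) v := by
  induction u generalizing s with
  | nil => rfl
  | cons x u ih => exact ih _

/-- The finite word written by the automaton that starts at the state `s` and reads `v`. -/
def outWord : S → List X → List X
  | _, [] => []
  | s, x :: v => A.out s x :: outWord (A.trans s x) v

@[simp]
theorem length_outWord (s : S) (v : List X) : (A.outWord s v).length = v.length := by
  induction v generalizing s with
  | nil => rfl
  | cons x v ih => simp [outWord, ih]

open Classical in
/-- The number of letters of `v` that move the automaton to a different state, when it starts at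
`s` and reads `v`. -/
noncomputable def changes : S → List X → ℕ
  | _, [] => 0
  | s, x :: v => (if A.trans s x = s then 0 else 1) + changes (A.trans s x) v

/-- The automaton that starts at `s` changes its state at most `K` times, whatever it reads. -/
def ChangesLE (K : ℕ) (s : S) : Prop :=
  ∀ v : List X, A.changes s v ≤ K

theorem changes_append (s : S) (u v : List X) :
    A.changes s (u ++ v) = A.changes s u + A.changes (A.sec s u) v := by
  induction u generalizing s with
  | nil => simp [changes, sec]
  | cons x u ih => simp [changes, sec, ih, add_assoc]

theorem changes_le_length (s : S) (v : List X) : A.changes s v ≤ v.length := by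
  induction v generalizing s with
  | nil => simp [changes]
  | cons x v ih =>
    have := ih (A.trans s x)
    simp only [changes, List.length_cons]
    split_ifs <;> omega

variable {A}

theorem ChangesLE.of_trans {K : ℕ} {s : S} (h : ∀ x, A.ChangesLE K (A.trans s x)) :
    A.ChangesLE (1 + K) s := by
  rintro (_ | ⟨x, v⟩)
  · simp [changes]
  · have := h x v
    simp only [changes]
    split_ifs <;> omega

theorem ChangesLE.trans_of_ne {K : ℕ} {s : S} (h : A.ChangesLE K s) {x : X}
    (hx : A.trans s x ≠ s) : ∃ K', K = K' + 1 ∧ A.ChangesLE K' (A.trans s x) := by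
  have h1 : ∀ v, 1 + A.changes (A.trans s x) v ≤ K := fun v => by
    simpa [changes, hx] using h (x :: v)
  obtain ⟨K', rfl⟩ : ∃ K', K = K' + 1 := ⟨K - 1, by have := h1 []; omega⟩
  exact ⟨K', rfl, fun v => by have := h1 v; omega⟩

theorem ChangesLE.zero_of_fixed {s : S} (h : ∀ x, A.trans s x = s) : A.ChangesLE 0 s := by
  intro v
  induction v with
  | nil => simp [changes]
  | cons x v ih => simpa [changes, h] using ih

end Sections

section Rows

variable {S Y : Type*} (A : Automaton S Y)

/-- The transition function of `Automaton.row`. -/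
def rowTrans : List S → Y → List S
  | [], _ => []
  | s :: l, y => A.trans s y :: rowTrans l (A.out s y)

/-- The output function of `Automaton.row`. -/
def rowOut : List S → Equiv.Perm Y
  | [] => 1
  | s :: l => rowOut l * A.out s

/-- The automaton whose states are rows of states of `A`: the row `[s₁, …, sₙ]` applies first `s₁`,
then `s₂`, and so on, so its transformation is the product of those of its members. -/
def row : Automaton (List S) Y where
  trans := A.rowTrans
  out := A.rowOut

@[simp] theorem row_trans_nil (y : Y) : A.row.trans [] y = [] := rfl

@[simp] theorem row_trans_cons (s : S) (l : List S) (y : Y) :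
    A.row.trans (s :: l) y = A.trans s y :: A.row.trans l (A.out s y) := rfl

@[simp] theorem row_out_nil : A.row.out [] = 1 := rfl

@[simp] theorem row_out_cons (s : S) (l : List S) : A.row.out (s :: l) = A.row.out l * A.out s := rfl

@[simp] theorem row_trans_append (l l' : List S) (y : Y) :
    A.row.trans (l ++ l') y = A.row.trans l y ++ A.row.trans l' (A.row.out l y) := by
  induction l generalizing y with
  | nil => rfl
  | cons s l ih => simp [ih]

@[simp] theorem row_out_append (l l' : List S) :
    A.row.out (l ++ l') = A.row.out l' * A.row.out l := by
  induction l with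
  | nil => simp
  | cons s l ih => simp [ih, mul_assoc]

@[simp] theorem length_row_trans (l : List S) (y : Y) : (A.row.trans l y).length = l.length := by
  induction l generalizing y with
  | nil => rfl
  | cons s l ih => simp [ih]

@[simp] theorem length_row_sec (l : List S) (v : List Y) : (A.row.sec l v).length = l.length := by
  induction v generalizing l with
  | nil => rfl
  | cons y v ih => simp [sec, ih]

theorem row_sec_append (l l' : List S) (v : List Y) :
    A.row.sec (l ++ l') v = A.row.sec l v ++ A.row.sec l' (A.row.outWord l v) := by
  induction v generalizing l l' with
  | nil => rfl
  | cons y v ih => simp [sec, outWord, ih]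

theorem changes_row_append_le (l l' : List S) (v : List Y) :
    A.row.changes (l ++ l') v ≤ A.row.changes l v + A.row.changes l' (A.row.outWord l v) := by
  induction v generalizing l l' with
  | nil => simp [changes]
  | cons y v ih =>
    have := ih (A.row.trans l y) (A.row.trans l' (A.row.out l y))
    rw [← row_trans_append] at this
    have key : A.row.trans l y = l → A.row.trans l' (A.row.out l y) = l' →
        A.row.trans (l ++ l') y = l ++ l' := fun h h' => by rw [row_trans_append, h, h']
    simp only [changes, outWord]
    split_ifs <;> first | omega | (exfalso; tauto)

variable {A}

theorem ChangesLE.append {K K' : ℕ} {l l' : List S} (h : A.row.ChangesLE K l)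
    (h' : A.row.ChangesLE K' l') : A.row.ChangesLE (K + K') (l ++ l') := fun v =>
  (A.changes_row_append_le l l' v).trans (Nat.add_le_add (h v) (h' _))

end Rows

/-! ### Graded automata: rigid blocks and the bound on the number of changes -/

section Graded

variable {S Y : Type*}

/-- The automaton `A` is graded by `deg`: the degree does not grow along arrows, every arrow lowers
the degree or ends at a state with a loop, a state of degree `0` with a loop is trivial, and at a
state of positive degree with a loop all other arrows lower the degree. -/
structure IsGraded (A : Automaton S Y) (deg : S → ℕ) : Prop where
  deg_trans_le : ∀ s y, deg (A.trans s y) ≤ deg s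
  lt_or_loop : ∀ s y, deg (A.trans s y) < deg s ∨ ∃ z, A.trans (A.trans s y) z = A.trans s y
  out_eq_one : ∀ s x, A.trans s x = s → deg s = 0 → A.out s = 1
  trans_eq_self : ∀ s x y, A.trans s x = s → deg s = 0 → A.trans s y = s
  deg_trans_lt : ∀ s x y, A.trans s x = s → deg s ≠ 0 → y ≠ x → deg (A.trans s y) < deg s

/-- All members of the row have degree at most `r`. -/
def Low (deg : S → ℕ) (r : ℕ) (l : List S) : Prop :=
  ∀ s ∈ l, deg s ≤ r

/-- A rigid row: it is fixed by one letter, and every other letter lowers the degree of all its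
members to at most `r`. -/
def Rigid (A : Automaton S Y) (deg : S → ℕ) (r : ℕ) (B : List S) : Prop :=
  ∃ x, A.row.trans B x = B ∧ ∀ y, y ≠ x → Low deg r (A.row.trans B y)

/-- The row consists of at most `b` rigid blocks, separated by members of degree at most `r`. -/
inductive HasBlocks (A : Automaton S Y) (deg : S → ℕ) (r : ℕ) : ℕ → List S → Prop
  | low {b : ℕ} {l : List S} : Low deg r l → HasBlocks A deg r b l
  | cons {b : ℕ} {l₀ B l : List S} : Low deg r l₀ → Rigid A deg r B → HasBlocks A deg r b l →
      HasBlocks A deg r (b + 1) (l₀ ++ (B ++ l))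

variable {A : Automaton S Y} {deg : S → ℕ} {r : ℕ}

theorem Low.append {l l' : List S} (h : Low deg r l) (h' : Low deg r l') :
    Low deg r (l ++ l') := by
  intro s hs
  rcases List.mem_append.1 hs with hs | hs
  exacts [h s hs, h' s hs]

theorem Low.row_trans (hA : A.IsGraded deg) {l : List S} (h : Low deg r l) (y : Y) :
    Low deg r (A.row.trans l y) := by
  induction l generalizing y with
  | nil => simpa using h
  | cons s l ih =>
    simp only [Low, List.forall_mem_cons] at h
    simp only [Low, row_trans_cons, List.forall_mem_cons]
    exact ⟨(hA.deg_trans_le s y).trans h.1, ih h.2 _⟩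

theorem Low.row_sec (hA : A.IsGraded deg) {l : List S} (h : Low deg r l) (v : List Y) :
    Low deg r (A.row.sec l v) := by
  induction v generalizing l with
  | nil => exact h
  | cons y v ih => exact ih (h.row_trans hA y)

namespace HasBlocks

theorem low_append {b : ℕ} {l₀ l : List S} (h₀ : Low deg r l₀) (h : HasBlocks A deg r b l) :
    HasBlocks A deg r b (l₀ ++ l) := by
  cases h with
  | low h => exact .low (h₀.append h)
  | cons h₁ hB h =>
    rw [← List.append_assoc]
    exact .cons (h₀.append h₁) hB h

theorem mono {a b : ℕ} {l : List S} (h : HasBlocks A deg r a l) (hab : a ≤ b) :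
    HasBlocks A deg r b l := by
  induction h generalizing b with
  | low h => exact .low h
  | cons h₀ hB _ ih =>
    obtain ⟨b, rfl⟩ : ∃ c, b = c + 1 := ⟨b - 1, by omega⟩
    exact .cons h₀ hB (ih (by omega))

theorem append {a b : ℕ} {l l' : List S} (h : HasBlocks A deg r a l)
    (h' : HasBlocks A deg r b l') : HasBlocks A deg r (a + b) (l ++ l') := by
  induction h with
  | low h => exact low_append h (h'.mono (by omega))
  | @cons a l₀ B l h₀ hB _ ih =>
    rw [Nat.add_right_comm, List.append_assoc, List.append_assoc]
    exact .cons h₀ hB ih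

theorem of_rigid {B : List S} (h : Rigid A deg r B) : HasBlocks A deg r 1 B := by
  simpa using HasBlocks.cons (b := 0) (l₀ := []) (l := []) (A := A) (r := r) (deg := deg)
    (by simp [Low]) h (.low (by simp [Low]))

theorem row_trans (hA : A.IsGraded deg) {b : ℕ} {l : List S} (h : HasBlocks A deg r b l) (y : Y) :
    HasBlocks A deg r b (A.row.trans l y) := by
  induction h generalizing y with
  | low h => exact .low (h.row_trans hA y)
  | @cons b l₀ B l h₀ hB _ ih =>
    obtain ⟨x, hx, hlow⟩ := id hB
    simp only [row_trans_append]
    by_cases hy : A.row.out l₀ y = x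
    · rw [hy, hx]
      exact .cons (h₀.row_trans hA y) hB (ih _)
    · rw [add_comm]
      exact low_append (h₀.row_trans hA y)
        (HasBlocks.append (.low (hlow _ hy)) (ih _))

theorem row_sec (hA : A.IsGraded deg) {b : ℕ} {l : List S} (h : HasBlocks A deg r b l)
    (v : List Y) : HasBlocks A deg r b (A.row.sec l v) := by
  induction v generalizing l with
  | nil => exact h
  | cons y v ih => exact ih (h.row_trans hA y)

/-- Two rigid blocks become at most one within `K + 1` letters, if the row between them changes at
most `K` times: as long as both blocks survive, that row reads a constant word, so it is fixed after
at most `K` letters, and then either the blocks merge into one rigid block or the next letter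
destroys one of them. -/
theorem merge (hA : A.IsGraded deg) {K : ℕ} {B₁ l B₂ : List S} (h₁ : Rigid A deg r B₁)
    (hl : Low deg r l) (h₂ : Rigid A deg r B₂) (hK : A.row.ChangesLE K l) {u : List Y}
    (hu : K + 1 ≤ u.length) : HasBlocks A deg r 1 (A.row.sec (B₁ ++ (l ++ B₂)) u) := by
  obtain ⟨x₁, hx₁, hlow₁⟩ := id h₁
  obtain ⟨x₂, hx₂, hlow₂⟩ := id h₂
  induction u generalizing K l with
  | nil => simp at hu
  | cons y u ih =>
    have step : HasBlocks A deg r 1 (A.row.trans (B₁ ++ (l ++ B₂)) y) →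
        HasBlocks A deg r 1 (A.row.sec (B₁ ++ (l ++ B₂)) (y :: u)) := fun h => h.row_sec hA u
    have hl' := fun z => hl.row_trans hA z
    by_cases hy : y = x₁
    · subst hy
      by_cases hz : A.row.out l (A.row.out B₁ y) = x₂
      · by_cases hf : A.row.trans l (A.row.out B₁ y) = l
        · refine (of_rigid ⟨y, by simp [hx₁, hf, hz, hx₂], fun y' hy' => ?_⟩).row_sec hA _
          simp only [row_trans_append]
          -- a wrong letter for `B₁` becomes a wrong letter for `B₂`, as outputs are permutations
          refine (hlow₁ _ hy').append ((hl' _).append (hlow₂ _ fun h => hy' ?_))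
          rw [← hz] at h
          exact (A.row.out B₁).injective ((A.row.out l).injective h)
        · obtain ⟨K', rfl, hK'⟩ := hK.trans_of_ne hf
          have := ih (hl' _) hK' (by simpa using hu)
          simpa [sec, hx₁, hz, hx₂] using this
      · apply step
        simp only [row_trans_append, hx₁]
        exact HasBlocks.append (b := 0) (of_rigid h₁) (.low ((hl' _).append (hlow₂ _ hz)))
    · apply step
      simp only [row_trans_append]
      exact low_append (hlow₁ _ hy) (low_append (hl' _) ((of_rigid h₂).row_trans hA _))

/-- The number of blocks is halved within `K + 1` letters. -/
theorem halve (hA : A.IsGraded deg) {K n : ℕ}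
    (hK : ∀ l : List S, Low deg r l → l.length ≤ n → A.row.ChangesLE K l) {b : ℕ} {l : List S}
    (h : HasBlocks A deg r b l) (hl : l.length ≤ n) {u : List Y} (hu : K + 1 ≤ u.length) :
    HasBlocks A deg r ((b + 1) / 2) (A.row.sec l u) := by
  induction b using Nat.strong_induction_on generalizing l u with
  | _ b ih =>
    cases h with
    | low h => exact .low (h.row_sec hA u)
    | @cons b l₀ B₁ l₁ h₀ h₁ h =>
      cases h with
      | low h =>
        have h1 : HasBlocks A deg r 1 (l₀ ++ (B₁ ++ l₁)) := .cons h₀ h₁ (.low h)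
        exact (h1.row_sec hA u).mono (by omega)
      | @cons b l B₂ l₂ hl' h₂ h =>
        simp only [List.length_append] at hl
        rw [show l₀ ++ (B₁ ++ (l ++ (B₂ ++ l₂))) = l₀ ++ ((B₁ ++ (l ++ B₂)) ++ l₂) by simp,
          row_sec_append, row_sec_append]
        refine low_append (h₀.row_sec hA u) (((merge hA h₁ hl' h₂ (hK l hl' (by omega))
          (u := A.row.outWord l₀ u) (by simpa using hu)).append
          (ih b (by omega) h (by omega) (by simpa using hu))).mono (by omega))

/-- The bound on the number of changes of a row with blocks. A single block costs `3 * K + 1`: its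
own disappearance, and the changes of low rows before it, after it, and in its place. -/
theorem changesLE (hA : A.IsGraded deg) {K n : ℕ}
    (hK : ∀ l : List S, Low deg r l → l.length ≤ n → A.row.ChangesLE K l) {b : ℕ} {l : List S}
    (h : HasBlocks A deg r b l) (hl : l.length ≤ n) :
    A.row.ChangesLE ((K + 1) * Nat.clog 2 b + 3 * K + 1) l := by
  induction b using Nat.strong_induction_on generalizing l with
  | _ b ih =>
    rcases Nat.lt_or_ge 1 b with hb | hb
    · intro v
      have h1 := A.row.changes_append l (v.take (K + 1)) (v.drop (K + 1))
      rw [List.take_append_drop] at h1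
      have h2 := A.row.changes_le_length l (v.take (K + 1))
      rw [List.length_take] at h2
      rw [Nat.clog_of_two_le one_lt_two hb, h1]
      rcases le_total (K + 1) v.length with hv | hv
      · have h3 := ih ((b + 1) / 2) (by omega)
          (h.halve hA hK hl (u := v.take (K + 1)) (by simp [hv])) (by simpa using hl)
          (v.drop (K + 1))
        rw [show b + 2 - 1 = b + 1 by omega, mul_add]
        omega
      · rw [List.drop_eq_nil_of_le hv]
        simp only [changes, mul_add]
        omega
    · replace h : HasBlocks A deg r 1 l := h.mono hb
      suffices A.row.ChangesLE (3 * K + 1) l from fun v => (this v).trans (by omega)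
      cases h with
      | low h => exact fun v => (hK l h hl v).trans (by omega)
      | @cons b l₀ B l h₀ hB h =>
        simp only [List.length_append] at hl
        have hB' : A.row.ChangesLE (1 + K) B := by
          obtain ⟨x, hx, hlow⟩ := hB
          intro v
          induction v with
          | nil => simp [changes]
          | cons y v ih =>
            by_cases hy : y = x
            · subst hy
              simpa [changes, hx] using ih
            · have := hK _ (hlow y hy) (by rw [length_row_trans]; omega) v
              simp only [changes]
              split_ifs <;> omega
        have h' : Low deg r l := by cases h; assumption
        have := (hK l₀ h₀ (by omega)).append (hB'.append (hK l h' (by omega)))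
        exact fun v => (this v).trans (by omega)

end HasBlocks

/-- A row of length at most `n` whose members have degree at most `r` changes at most
`2 (⌈log₂ n⌉ + 3) ^ r - 1` times. -/
theorem IsGraded.changesLE (hA : A.IsGraded deg) (n : ℕ) {l : List S} (h : Low deg r l)
    (hl : l.length ≤ n) : A.row.ChangesLE (2 * (Nat.clog 2 n + 3) ^ r - 1) l := by
  induction r generalizing l with
  | zero =>
    refine ChangesLE.of_trans (K := 0) fun y => ChangesLE.zero_of_fixed ?_
    clear hl
    induction l generalizing y with
    | nil => simp
    | cons s l ih =>
      simp only [Low, List.forall_mem_cons] at h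
      intro z
      have h0 : deg s = 0 := by simpa using h.1
      obtain h1 | ⟨x, hx⟩ := hA.lt_or_loop s y
      · omega
      · have h2 := hA.deg_trans_le s y
        simp [hA.trans_eq_self _ x z hx (by omega), hA.out_eq_one _ x hx (by omega), ih h.2]
  | succ r ih =>
    set K := 2 * (Nat.clog 2 n + 3) ^ r - 1 with hK
    have hpos : 0 < (Nat.clog 2 n + 3) ^ r := by positivity
    -- after one letter every member of degree `r + 1` has a loop, so it is a rigid block
    have key : ∀ y, HasBlocks A deg r l.length (A.row.trans l y) := by
      clear hl
      intro y
      induction l generalizing y with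
      | nil => exact .low (by simp [Low])
      | cons s l ihl =>
        simp only [Low, List.forall_mem_cons] at h
        have h1 : HasBlocks A deg r 1 [A.trans s y] := by
          rcases Nat.lt_or_ge r (deg (A.trans s y)) with hr | hr
          · have h2 := h.1
            obtain h3 | ⟨x, hx⟩ := hA.lt_or_loop s y
            · omega
            have h4 := hA.deg_trans_le s y
            refine HasBlocks.of_rigid ⟨x, by simp [hx], fun z hz => ?_⟩
            have := hA.deg_trans_lt _ x z hx (by omega) hz
            simp only [Low, row_trans_cons, row_trans_nil, List.mem_singleton, forall_eq]
            omega
          · exact .low (by simpa [Low] using hr)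
        simpa [add_comm] using h1.append (ihl h.2 (A.out s y))
    have := ChangesLE.of_trans fun y =>
      (key y).changesLE hA (fun l h hl => ih h hl) (by simpa using hl)
    refine fun v => (this v).trans ?_
    have h2 := Nat.mul_le_mul_left (K + 1) (Nat.clog_mono_right 2 hl)
    have h3 : 2 * (Nat.clog 2 n + 3) ^ (r + 1) = (K + 1) * Nat.clog 2 n + 3 * (K + 1) := by
      rw [hK, Nat.sub_add_cancel (by omega)]; ring
    omega

end Graded

end Automaton

/-! ### Counting the images of an infinite word -/

namespace Automaton

section Act

variable {S X : Type*} (A : Automaton S X)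

theorem stateAt_succ' (s : S) (w : ℕ → X) (n : ℕ) :
    A.stateAt s w (n + 1) = A.stateAt (A.trans s (w 0)) (fun k => w (k + 1)) n := by
  induction n with
  | zero => rfl
  | succ n ih => rw [stateAt, ih]; rfl

theorem act_succ (s : S) (w : ℕ → X) (n : ℕ) :
    A.act s w (n + 1) = A.act (A.trans s (w 0)) (fun k => w (k + 1)) n := by
  simp only [act, stateAt_succ']

theorem stateAt_add (s : S) (w : ℕ → X) (p n : ℕ) :
    A.stateAt s w (p + n) = A.stateAt (A.stateAt s w p) (fun k => w (p + k)) n := by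
  induction n with
  | zero => rfl
  | succ n ih => rw [← add_assoc, stateAt, ih]; rfl

theorem act_add (s : S) (w : ℕ → X) (p n : ℕ) :
    A.act s w (p + n) = A.act (A.stateAt s w p) (fun k => w (p + k)) n := by
  simp only [act, stateAt_add]

variable {A}

theorem stateAt_eq_self {s : S} {w : ℕ → X} {p : ℕ} (h : ∀ k < p, A.trans s (w k) = s) :
    A.stateAt s w p = s := by
  induction p with
  | zero => rfl
  | succ p ih => rw [stateAt, ih fun k hk => h k (by omega), h p (by omega)]

theorem row_stateAt_append (l l' : List S) (w : ℕ → X) (n : ℕ) :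
    A.row.stateAt (l ++ l') w n = A.row.stateAt l w n ++ A.row.stateAt l' (A.row.act l w) n := by
  induction n with
  | zero => rfl
  | succ n ih => simp only [stateAt, ih, row_trans_append]; rfl

theorem row_act_append (l l' : List S) (w : ℕ → X) :
    A.row.act (l ++ l') w = A.row.act l' (A.row.act l w) := by
  funext n
  simp only [act, row_stateAt_append, row_out_append, Equiv.Perm.mul_apply]

theorem row_act_nil (w : ℕ → X) : A.row.act [] w = w := by
  funext n
  have : A.row.stateAt [] w n = [] := stateAt_eq_self fun _ _ => rfl
  simp [act, this]

theorem row_act_singleton (s : S) (w : ℕ → X) : A.row.act [s] w = A.act s w := by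
  have h : ∀ n, A.row.stateAt [s] w n = [A.stateAt s w n] := fun n => by
    induction n with
    | zero => rfl
    | succ n ih => simp [stateAt, ih]
  funext n
  simp [act, h]

end Act

section Counting

variable {S Y : Type*} {A : Automaton S Y} {deg : S → ℕ}

/-- A row that is fixed by two different letters is trivial. -/
theorem IsGraded.row_trivial (hA : A.IsGraded deg) {l : List S} {x x' : Y}
    (hx : A.row.trans l x = l) (hx' : A.row.trans l x' = l) (hne : x ≠ x') :
    A.row.out l = 1 ∧ ∀ y, A.row.trans l y = l := by
  induction l generalizing x x' with
  | nil => simp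
  | cons s l ih =>
    simp only [row_trans_cons, List.cons.injEq] at hx hx'
    have h0 : deg s = 0 := by
      by_contra h
      have := hA.deg_trans_lt s x x' hx.1 h hne.symm
      rw [hx'.1] at this
      omega
    have h1 := ih hx.2 hx'.2 fun h => hne ((A.out s).injective h)
    refine ⟨by simp [h1.1, hA.out_eq_one s x hx.1 h0], fun y => ?_⟩
    simp [h1.2, hA.trans_eq_self s x y hx.1 h0]

/-- The infinite word `aaa…abf` with `p` letters `a`. -/
def glue (p : ℕ) (a b : Y) (f : ℕ → Y) : ℕ → Y :=
  fun n => if n < p then a else if n = p then b else f (n - (p + 1))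

theorem act_eq_glue {s : S} {w : ℕ → Y} {p : ℕ} (hw : ∀ k < p, w k = w 0)
    (hs : 0 < p → A.trans s (w 0) = s) :
    A.act s w = glue p (A.out s (w 0)) (A.out s (w p))
      (A.act (A.trans s (w p)) fun k => w (p + 1 + k)) := by
  have hst : ∀ k ≤ p, A.stateAt s w k = s := fun k hk =>
    stateAt_eq_self fun j hj => by rw [hw j (by omega), hs (by omega)]
  funext n
  unfold glue
  split_ifs with h1 h2
  · simp only [act, hst n h1.le, hw n h1]
  · subst h2
    simp only [act, hst n le_rfl]
  · obtain ⟨j, rfl⟩ : ∃ j, n = p + 1 + j := ⟨n - (p + 1), by omega⟩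
    rw [act_add, stateAt, hst p le_rfl, Nat.add_sub_cancel_left]

/-- The rows that change few times send a given infinite word to few infinite words. Such an image
is determined by the letters written at the changes and by the letters written while the row is
fixed: after a change either the row changes again at once, or it is fixed until the letter of
the given word changes, and what it writes in between is constant. -/
theorem IsGraded.exists_finset_act [Fintype Y] [Nontrivial Y] (hA : A.IsGraded deg) (N : ℕ)
    (w : ℕ → Y) : ∃ F : Finset (ℕ → Y), F.card ≤ Fintype.card Y ^ (4 * N) ∧
      ∀ (K : ℕ) (l : List S), K < N → A.row.ChangesLE K l → A.row.act l w ∈ F := by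
  classical
  induction N generalizing w with
  | zero => exact ⟨∅, by simp⟩
  | succ N ih =>
    -- `p` is the position of the first letter of `w` that differs from `w 0`, if there is one
    obtain ⟨p, hp, hp'⟩ : ∃ p, (∀ k < p, w k = w 0) ∧ (w p = w 0 → ∀ k, w k = w 0) := by
      by_cases h : ∃ p, w p ≠ w 0
      · exact ⟨Nat.find h, fun k hk => by simpa using Nat.find_min h hk,
          fun h' => absurd h' (Nat.find_spec h)⟩
      · push Not at h
        exact ⟨0, by simp, fun _ => h⟩
    obtain ⟨F₁, hF₁, hF₁'⟩ := ih fun k => w (0 + 1 + k)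
    obtain ⟨F₂, hF₂, hF₂'⟩ := ih fun k => w (p + 1 + k)
    set q := Fintype.card Y with hq
    let g : ℕ → Y × Y × (ℕ → Y) → ℕ → Y := fun p a => glue p a.1 a.2.1 a.2.2
    refine ⟨insert w (Finset.univ.image (fun (a : Y) (_ : ℕ) => a) ∪
      ((Finset.univ ×ˢ Finset.univ ×ˢ F₁).image (g 0) ∪
        (Finset.univ ×ˢ Finset.univ ×ˢ F₂).image (g p))), ?_, ?_⟩
    · have h1 : (Finset.univ.image (fun (a : Y) (_ : ℕ) => a)).card ≤ q := by
        simpa using Finset.card_image_le (s := (Finset.univ : Finset Y))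
          (f := fun (a : Y) (_ : ℕ) => a)
      have h2 : ∀ (p : ℕ) (F : Finset (ℕ → Y)), F.card ≤ q ^ (4 * N) →
          ((Finset.univ ×ˢ Finset.univ ×ˢ F).image (g p)).card ≤ q * (q * q ^ (4 * N)) := by
        intro p F hF
        refine Finset.card_image_le.trans ?_
        rw [Finset.card_product, Finset.card_product, Finset.card_univ]
        gcongr
      have hq2 : 2 ≤ q := Fintype.one_lt_card
      have h3 : 1 + q ≤ q * q * q ^ (4 * N) := by
        have : 1 ≤ q ^ (4 * N) := Nat.one_le_pow _ _ (by omega)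
        nlinarith
      have h4 : 4 * (q * q * q ^ (4 * N)) ≤ q ^ (4 * (N + 1)) := by
        rw [show q ^ (4 * (N + 1)) = (q * q) * (q * q * q ^ (4 * N)) by ring]
        gcongr
        nlinarith
      refine (Finset.card_insert_le _ _).trans ?_
      have h5 := Finset.card_union_le (Finset.univ.image (fun (a : Y) (_ : ℕ) => a))
        ((Finset.univ ×ˢ Finset.univ ×ˢ F₁).image (g 0) ∪
          (Finset.univ ×ˢ Finset.univ ×ˢ F₂).image (g p))
      have h6 := Finset.card_union_le ((Finset.univ ×ˢ Finset.univ ×ˢ F₁).image (g 0))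
        ((Finset.univ ×ˢ Finset.univ ×ˢ F₂).image (g p))
      have h7 := h2 0 F₁ hF₁
      have h8 := h2 p F₂ hF₂
      rw [← mul_assoc] at h7 h8
      omega
    · intro K l hK hl
      simp only [Finset.mem_insert, Finset.mem_union, Finset.mem_image, Finset.mem_univ,
        Finset.mem_product, true_and]
      by_cases hf : A.row.trans l (w 0) = l
      · by_cases hc : w p = w 0
        · refine .inr (.inl ⟨A.row.out l (w 0), ?_⟩)
          funext n
          rw [act, stateAt_eq_self fun k _ => by rw [hp' hc, hf], hp' hc n]
        · by_cases hf' : A.row.trans l (w p) = l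
          · obtain ⟨h1, h2⟩ := hA.row_trivial hf hf' (Ne.symm hc)
            left
            funext n
            rw [act, stateAt_eq_self fun k _ => h2 _, h1]
            rfl
          · obtain ⟨K', rfl, hK'⟩ := hl.trans_of_ne hf'
            exact .inr (.inr (.inr ⟨(_, _, _), hF₂' K' _ (by omega) hK',
              (act_eq_glue hp fun _ => hf).symm⟩))
      · obtain ⟨K', rfl, hK'⟩ := hl.trans_of_ne hf
        exact .inr (.inr (.inl ⟨(_, _, _), hF₁' K' _ (by omega) hK',
          (act_eq_glue (p := 0) (by simp) (by simp)).symm⟩))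

end Counting

end Automaton

/-! ### Cycles and degrees in polynomial automata -/

namespace Automaton

section Cycles

variable {S X : Type*} {A : Automaton S X}

theorem arrows_append (s : S) (u v : List X) :
    A.arrows s (u ++ v) = A.arrows s u ++ A.arrows (A.sec s u) v := by
  induction u generalizing s with
  | nil => rfl
  | cons x u ih => simp [arrows, sec, ih]

theorem length_arrows (s : S) (v : List X) : (A.arrows s v).length = v.length := by
  induction v generalizing s with
  | nil => rfl
  | cons x v ih => simp [arrows, ih]

theorem exists_sec_of_mem_arrows {s : S} {v : List X} {a : S × X} (h : a ∈ A.arrows s v) :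
    ∃ v₁ v₂, v = v₁ ++ a.2 :: v₂ ∧ A.sec s v₁ = a.1 := by
  induction v generalizing s with
  | nil => simp [arrows] at h
  | cons x v ih =>
    rcases List.mem_cons.1 h with rfl | h
    · exact ⟨[], v, rfl, rfl⟩
    · obtain ⟨v₁, v₂, rfl, h'⟩ := ih h
      exact ⟨x :: v₁, v₂, rfl, h'⟩

/-- A path that passes through some state twice contains a closed path. -/
theorem exists_closed_of_not_nodup {s : S} {v : List X}
    (h : ¬ ((A.arrows s v).map Prod.fst).Nodup) :
    ∃ v₁ v₂ v₃, v = v₁ ++ (v₂ ++ v₃) ∧ v₂ ≠ [] ∧ v₃ ≠ [] ∧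
      A.sec (A.sec s v₁) v₂ = A.sec s v₁ := by
  induction v generalizing s with
  | nil => simp [arrows] at h
  | cons x v ih =>
    simp only [arrows, List.map_cons, List.nodup_cons, not_and_or, not_not] at h
    rcases h with h | h
    · obtain ⟨a, ha, hs⟩ := List.mem_map.1 h
      obtain ⟨v₁, v₂, rfl, h'⟩ := exists_sec_of_mem_arrows ha
      exact ⟨[], x :: v₁, a.2 :: v₂, by simp, by simp, by simp, by simp only [sec, h', hs]⟩
    · obtain ⟨v₁, v₂, v₃, rfl, h₂, h₃, h⟩ := ih h
      exact ⟨x :: v₁, v₂, v₃, rfl, h₂, h₃, h⟩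

/-- Every arrow on a closed path that begins with it lies on a cycle: shorten the path. -/
theorem exists_isCycle {s : S} {x : X} {u : List X} (h : A.sec s (x :: u) = s) :
    ∃ C, A.IsCycle C ∧ (s, x) ∈ C := by
  induction hn : u.length using Nat.strong_induction_on generalizing u with
  | _ n ih =>
    by_cases hnd : ((A.arrows s (x :: u)).map Prod.fst).Nodup
    · exact ⟨_, ⟨s, x :: u, by simp, h, hnd, rfl⟩, by simp [arrows]⟩
    · obtain ⟨v₁, v₂, v₃, hv, h₂, h₃, hc⟩ := exists_closed_of_not_nodup hnd
      have hlen := congrArg List.length hv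
      have := List.length_pos_iff.2 h₂
      have := List.length_pos_iff.2 h₃
      simp only [List.length_append, List.length_cons, hn] at hlen
      cases v₁ with
      | nil =>
        cases v₂ with
        | nil => simp at h₂
        | cons y v₂ =>
          obtain ⟨rfl, rfl⟩ : x = y ∧ u = v₂ ++ v₃ := by simpa using hv
          exact ih v₂.length (by simp at hlen; omega) (by simpa [sec] using hc) rfl
      | cons y v₁ =>
        obtain ⟨rfl, rfl⟩ : x = y ∧ u = v₁ ++ (v₂ ++ v₃) := by simpa using hv
        refine ih (v₁ ++ v₃).length (by simp at hlen ⊢; omega) ?_ rfl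
        rw [← List.cons_append, sec_append, ← hc]
        rwa [← List.cons_append, sec_append, sec_append] at h

variable {C : Set (S × X)}

/-- A cycle may be read from any of its states. -/
theorem IsCycle.exists_word (hC : A.IsCycle C) {s : S} (hs : s ∈ Prod.fst '' C) :
    ∃ v : List X, v ≠ [] ∧ A.sec s v = s ∧ ((A.arrows s v).map Prod.fst).Nodup ∧
      C = {a | a ∈ A.arrows s v} := by
  obtain ⟨s₀, v, hv, hs₀, hnd, rfl⟩ := hC
  obtain ⟨a, ha, rfl⟩ := hs
  obtain ⟨v₁, v₂, rfl, h⟩ := exists_sec_of_mem_arrows ha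
  rw [sec_append, h] at hs₀
  have e₁ : A.arrows s₀ (v₁ ++ a.2 :: v₂) = A.arrows s₀ v₁ ++ A.arrows a.1 (a.2 :: v₂) := by
    rw [arrows_append, h]
  have e₂ : A.arrows a.1 (a.2 :: v₂ ++ v₁) = A.arrows a.1 (a.2 :: v₂) ++ A.arrows s₀ v₁ := by
    rw [arrows_append, hs₀]
  refine ⟨a.2 :: v₂ ++ v₁, by simp, by rw [sec_append, hs₀, h], ?_, ?_⟩
  · rw [e₂]
    rw [e₁] at hnd
    exact ((List.perm_append_comm).map _).nodup_iff.1 hnd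
  · ext b
    simp only [e₁, e₂, Set.mem_ofPred_eq, List.mem_append, or_comm]

theorem IsCycle.letter_unique (hC : A.IsCycle C) {s : S} {x y : X} (hx : (s, x) ∈ C)
    (hy : (s, y) ∈ C) : x = y := by
  obtain ⟨s₀, v, -, -, hnd, rfl⟩ := hC
  exact congrArg Prod.snd (List.inj_on_of_nodup_map hnd hx hy rfl)

theorem IsCycle.trans_mem (hC : A.IsCycle C) {s : S} {x : X} (hx : (s, x) ∈ C) :
    A.trans s x ∈ Prod.fst '' C := by
  obtain ⟨v, hv, hs, -, hCv⟩ := hC.exists_word ⟨_, hx, rfl⟩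
  cases v with
  | nil => simp at hv
  | cons y v =>
    obtain rfl : y = x := hC.letter_unique (by simp [hCv, arrows]) hx
    cases v with
    | nil => exact ⟨_, hx, by simpa [sec] using hs.symm⟩
    | cons z v => exact ⟨(A.trans s y, z), by simp [hCv, arrows], rfl⟩

theorem IsCycle.exists_sec_eq (hC : A.IsCycle C) {s s' : S} (hs : s ∈ Prod.fst '' C)
    (hs' : s' ∈ Prod.fst '' C) : ∃ u, A.sec s u = s' := by
  obtain ⟨v, -, -, -, hCv⟩ := hC.exists_word hs
  obtain ⟨a, ha, rfl⟩ := hs'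
  rw [hCv] at ha
  obtain ⟨v₁, v₂, -, h⟩ := exists_sec_of_mem_arrows ha
  exact ⟨v₁, h⟩

theorem IsCycle.isNontrivialCycle (hC : A.IsCycle C) {s : S} (hs : s ∈ Prod.fst '' C)
    (h : A.act s ≠ id) : A.IsNontrivialCycle C := by
  refine ⟨hC, ?_⟩
  rintro ⟨-, s', x, rfl, h'⟩
  obtain ⟨a, rfl, rfl⟩ := hs
  exact h h'

/-- In a minimized automaton all arrows that leave a trivial state are loops. -/
theorem IsMinimized.eq_of_act_eq_id (hm : A.IsMinimized) {s : S} (h : A.act s = id) :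
    A.out s = 1 ∧ ∀ x, A.trans s x = s := by
  have key : ∀ x (w : ℕ → X), A.out s x = x ∧ A.act (A.trans s x) w = w := by
    intro x w
    have h1 := congrFun h fun n => Nat.casesOn n x w
    refine ⟨congrFun h1 0, funext fun n => ?_⟩
    have h2 := congrFun h1 (n + 1)
    rw [act_succ] at h2
    exact h2
  refine ⟨Equiv.ext fun x => (key x fun _ => x).1, fun x => hm ?_⟩
  rw [h]
  exact funext fun w => (key x w).2

theorem IsMinimized.sec_of_act_eq_id (hm : A.IsMinimized) {s : S} (h : A.act s = id)
    (u : List X) : A.sec s u = s := by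
  induction u with
  | nil => rfl
  | cons x u ih => rw [sec, (hm.eq_of_act_eq_id h).2, ih]

theorem IsNontrivialCycle.act_ne_id (hm : A.IsMinimized) (hC : A.IsNontrivialCycle C) {s : S}
    (hs : s ∈ Prod.fst '' C) : A.act s ≠ id := by
  intro h
  obtain ⟨v, hv, -, hnd, hCv⟩ := hC.1.exists_word hs
  rcases v with _ | ⟨x, _ | ⟨y, v⟩⟩
  · simp at hv
  · exact hC.2 ⟨hC.1, s, x, by simpa [arrows] using hCv, h⟩
  · simp [arrows, (hm.eq_of_act_eq_id h).2] at hnd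

/-- A path that leaves a nontrivial cycle of a polynomial automaton never returns to it. -/
theorem IsNontrivialCycle.sec_notMem (hm : A.IsMinimized) (hp : A.IsPolynomial)
    (hC : A.IsNontrivialCycle C) {s : S} {x : X} (hs : s ∈ Prod.fst '' C) (hx : (s, x) ∉ C)
    (u : List X) : A.sec (A.trans s x) u ∉ Prod.fst '' C := by
  intro hu
  obtain ⟨u', hu'⟩ := hC.1.exists_sec_eq hu hs
  obtain ⟨C', hC', hx'⟩ := exists_isCycle (s := s) (x := x) (u := u ++ u')
    (A := A) (by rw [sec, sec_append, hu'])
  have hs' : s ∈ Prod.fst '' C' := ⟨_, hx', rfl⟩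
  exact Set.disjoint_left.1 (hp C C' hC (hC'.isNontrivialCycle hs' (hC.act_ne_id hm hs))
    fun h => hx (h ▸ hx')) hs hs'

end Cycles

section Degree

variable {S X : Type*} {A : Automaton S X} {m : ℤ}

variable (A) in
/-- The numbers of nontrivial cycles that are visited by one path from `s`. -/
def cycleCounts (s : S) : Set ℕ :=
  {k | ∃ (v : List X) (F : Finset (Set (S × X))),
    (∀ C ∈ F, A.IsNontrivialCycle C ∧ ∃ u : List X, u <+: v ∧ A.sec s u ∈ Prod.fst '' C) ∧
      F.card = k}

variable (A) in
/-- The degree of the state `s`: the greatest number of nontrivial cycles that are visited by one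
path from `s`. This is one more than the degree of the automaton that `s` generates. -/
noncomputable def degree (s : S) : ℕ :=
  sSup (A.cycleCounts s)

theorem HasDegreeLE.le_of_mem (hd : A.HasDegreeLE m) {s : S} {k : ℕ} (hk : k ∈ A.cycleCounts s) :
    k ≤ (m + 1).toNat := by
  obtain ⟨v, F, hF, rfl⟩ := hk
  have := hd s v F hF
  omega

theorem HasDegreeLE.le_degree (hd : A.HasDegreeLE m) {s : S} {k : ℕ}
    (hk : k ∈ A.cycleCounts s) : k ≤ A.degree s :=
  le_csSup ⟨_, fun _ h => hd.le_of_mem h⟩ hk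

theorem HasDegreeLE.degree_mem (hd : A.HasDegreeLE m) (s : S) : A.degree s ∈ A.cycleCounts s :=
  Nat.sSup_mem ⟨0, [], ∅, by simp⟩ ⟨_, fun _ h => hd.le_of_mem h⟩

theorem HasDegreeLE.degree_le (hd : A.HasDegreeLE m) (s : S) : A.degree s ≤ (m + 1).toNat :=
  hd.le_of_mem (hd.degree_mem s)

theorem HasDegreeLE.degree_sec_le (hd : A.HasDegreeLE m) (s : S) (u : List X) :
    A.degree (A.sec s u) ≤ A.degree s := by
  obtain ⟨v, F, hF, h⟩ := hd.degree_mem (A.sec s u)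
  refine hd.le_degree ⟨u ++ v, F, fun C hC => ⟨(hF C hC).1, ?_⟩, h⟩
  obtain ⟨u', hu', h'⟩ := (hF C hC).2
  exact ⟨u ++ u', (List.prefix_append_right_inj u).2 hu', by rwa [sec_append]⟩

theorem HasDegreeLE.degree_pos (hd : A.HasDegreeLE m) {C : Set (S × X)}
    (hC : A.IsNontrivialCycle C) {s : S} (hs : s ∈ Prod.fst '' C) : 0 < A.degree s :=
  hd.le_degree ⟨[], {C}, by simpa [sec, hC] using hs, by simp⟩

/-- The arrows that leave a nontrivial cycle lower the degree. -/
theorem HasDegreeLE.degree_trans_lt (hd : A.HasDegreeLE m) (hm : A.IsMinimized)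
    (hp : A.IsPolynomial) {C : Set (S × X)} (hC : A.IsNontrivialCycle C) {s : S} {x : X}
    (hs : s ∈ Prod.fst '' C) (hx : (s, x) ∉ C) : A.degree (A.trans s x) < A.degree s := by
  classical
  obtain ⟨v, F, hF, h⟩ := hd.degree_mem (A.trans s x)
  have hCF : C ∉ F := fun h => by
    obtain ⟨u, -, hu⟩ := (hF C h).2
    exact hC.sec_notMem hm hp hs hx u hu
  refine hd.le_degree ⟨x :: v, insert C F, fun C' hC' => ?_, ?_⟩
  · rcases Finset.mem_insert.1 hC' with rfl | hC'
    · exact ⟨hC, [], by simp, hs⟩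
    · obtain ⟨u, hu, h'⟩ := (hF C' hC').2
      exact ⟨(hF C' hC').1, x :: u, (List.cons_prefix_cons).2 ⟨rfl, hu⟩, h'⟩
  · rw [Finset.card_insert_of_notMem hCF, h]

theorem HasDegreeLE.sec_mem_or_degree_lt (hd : A.HasDegreeLE m) (hm : A.IsMinimized)
    (hp : A.IsPolynomial) {C : Set (S × X)} (hC : A.IsNontrivialCycle C) {s : S}
    (hs : s ∈ Prod.fst '' C) (u : List X) :
    A.sec s u ∈ Prod.fst '' C ∨ A.degree (A.sec s u) < A.degree s := by
  induction u generalizing s with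
  | nil => exact .inl hs
  | cons x u ih =>
    by_cases hx : (s, x) ∈ C
    · exact (ih (hC.1.trans_mem hx)).imp_right fun h => h.trans_le (hd.degree_sec_le s [x])
    · exact .inr ((hd.degree_sec_le _ u).trans_lt (hd.degree_trans_lt hm hp hC hs hx))

/-- Of the words of a given length, at most one leads from a given state of a nontrivial cycle to
a state of this cycle; the other ones lower the degree. -/
theorem HasDegreeLE.degree_sec_lt_of_ne (hd : A.HasDegreeLE m) (hm : A.IsMinimized)
    (hp : A.IsPolynomial) {C : Set (S × X)} (hC : A.IsNontrivialCycle C) {s : S}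
    (hs : s ∈ Prod.fst '' C) {u v : List X} (hu : A.sec s u ∈ Prod.fst '' C)
    (hlen : v.length = u.length) (hne : v ≠ u) : A.degree (A.sec s v) < A.degree s := by
  induction u generalizing s v with
  | nil => exact absurd (List.length_eq_zero_iff.1 hlen) hne
  | cons x u ih =>
    cases v with
    | nil => simp at hlen
    | cons y v =>
      have hx : (s, x) ∈ C := by
        by_contra hx
        exact hC.sec_notMem hm hp hs hx u hu
      by_cases hxy : y = x
      · subst hxy
        exact (ih (hC.1.trans_mem hx) hu (by simpa using hlen) (by simpa using hne)).trans_le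
          (hd.degree_sec_le s [y])
      · exact (hd.degree_sec_le _ v).trans_lt (hd.degree_trans_lt hm hp hC hs
          fun h => hxy (hC.1.letter_unique h hx))

theorem HasDegreeLE.act_eq_id_of_degree_eq_zero (hd : A.HasDegreeLE m) {s : S} {u : List X}
    (hu : A.sec s u = s) (hne : u ≠ []) (h : A.degree s = 0) : A.act s = id := by
  by_contra hs
  cases u with
  | nil => exact hne rfl
  | cons x u =>
    obtain ⟨C, hC, hx⟩ := exists_isCycle hu
    exact (hd.degree_pos (hC.isNontrivialCycle ⟨_, hx, rfl⟩ hs) ⟨_, hx, rfl⟩).ne' h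

theorem HasDegreeLE.degree_eq_zero_of_act_eq_id (hd : A.HasDegreeLE m) (hm : A.IsMinimized)
    {s : S} (h : A.act s = id) : A.degree s = 0 := by
  obtain ⟨v, F, hF, hk⟩ := hd.degree_mem s
  rw [← hk, Finset.card_eq_zero, Finset.eq_empty_iff_forall_notMem]
  intro C hC
  obtain ⟨h1, u, -, hu⟩ := hF C hC
  rw [hm.sec_of_act_eq_id h] at hu
  exact h1.act_ne_id hm hu h

theorem HasDegreeLE.degree_sec_lt (hd : A.HasDegreeLE m) (hm : A.IsMinimized)
    (hp : A.IsPolynomial) {s : S} {u v : List X} (hu : A.sec s u = s) (h : A.degree s ≠ 0)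
    (hlen : v.length = u.length) (hne : v ≠ u) : A.degree (A.sec s v) < A.degree s := by
  cases u with
  | nil => exact absurd (List.length_eq_zero_iff.1 hlen) hne
  | cons x u =>
    obtain ⟨C, hC, hx⟩ := exists_isCycle hu
    have hs : s ∈ Prod.fst '' C := ⟨_, hx, rfl⟩
    exact hd.degree_sec_lt_of_ne hm hp (hC.isNontrivialCycle hs fun h' =>
      h (hd.degree_eq_zero_of_act_eq_id hm h')) hs
      (by rwa [hu]) hlen hne

/-- If the length `L` is larger than the number of states and divisible by the lengths of all
cycles, then a word of length `L` lowers the degree or leads to a state from which some word of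
length `L` leads back. -/
theorem HasDegreeLE.degree_sec_lt_or_exists [Finite S] (hd : A.HasDegreeLE m) (hm : A.IsMinimized)
    (hp : A.IsPolynomial) {L : ℕ} (hL : 0 < L) (hdvd : (Nat.card S + 1).factorial ∣ L) (s : S)
    {u : List X} (hu : u.length = L) :
    A.degree (A.sec s u) < A.degree s ∨
      ∃ v : List X, v.length = L ∧ A.sec (A.sec s u) v = A.sec s u := by
  have := Fintype.ofFinite S
  have hcard : ∀ {s : S} {v : List X}, ((A.arrows s v).map Prod.fst).Nodup →
      v.length ≤ Nat.card S := fun {s v} h => by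
    simpa [length_arrows, Nat.card_eq_fintype_card] using h.length_le_card
  have hlt : Nat.card S < L :=
    (Nat.self_le_factorial (Nat.card S + 1)).trans (Nat.le_of_dvd hL hdvd)
  obtain ⟨v₁, v₂, v₃, rfl, h₂, -, hc⟩ := exists_closed_of_not_nodup (A := A) (s := s) (v := u)
    fun h => by have := hcard h; omega
  cases v₂ with
  | nil => simp at h₂
  | cons x v₂ =>
    by_cases hid : A.act (A.sec s v₁) = id
    · refine .inr ⟨List.replicate L x, by simp, ?_⟩
      simp only [sec_append, hm.sec_of_act_eq_id hid]
    · obtain ⟨C, hC, hx⟩ := exists_isCycle hc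
      have hs : A.sec s v₁ ∈ Prod.fst '' C := ⟨_, hx, rfl⟩
      replace hC := hC.isNontrivialCycle hs hid
      rw [sec_append]
      rcases hd.sec_mem_or_degree_lt hm hp hC hs (x :: v₂ ++ v₃) with h | h
      · obtain ⟨v, hv, hsv, hnd, -⟩ := hC.1.exists_word h
        have hv' := hcard hnd
        obtain ⟨k, hk⟩ : v.length ∣ L :=
          (Nat.dvd_factorial (List.length_pos_iff.2 hv) (by omega)).trans hdvd
        refine .inr ⟨(List.replicate k v).flatten, by simp [hk, mul_comm], ?_⟩
        clear hk
        induction k with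
        | zero => rfl
        | succ k ih => rw [List.replicate_succ, List.flatten_cons, sec_append, hsv, ih]
      · exact .inl (h.trans_le (hd.degree_sec_le s v₁))

end Degree

end Automaton

/-! ### Passing to blocks of letters -/

namespace Automaton

section Blocks

variable {ι : Type*} {S : ι → Type*} {Q X : Type*}

theorem outWord_injective (A : Automaton Q X) (s : Q) : Function.Injective (A.outWord s) := by
  intro u v h
  induction u generalizing s v with
  | nil => cases v <;> simp_all [outWord]
  | cons x u ih =>
    cases v with
    | nil => simp [outWord] at h
    | cons y v =>
      simp only [outWord, List.cons.injEq, EmbeddingLike.apply_eq_iff_eq] at h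
      obtain ⟨rfl, h⟩ := h
      rw [ih _ h]

theorem sec_ofFn (A : Automaton Q X) (s : Q) (w : ℕ → X) (L : ℕ) :
    A.sec s (List.ofFn fun k : Fin L => w k) = A.stateAt s w L := by
  induction L generalizing s w with
  | zero => rfl
  | succ L ih =>
    rw [List.ofFn_succ, sec, stateAt_succ']
    exact ih _ fun k => w (k + 1)

theorem outWord_ofFn (A : Automaton Q X) (s : Q) (w : ℕ → X) (L : ℕ) :
    A.outWord s (List.ofFn fun k : Fin L => w k) = List.ofFn fun k : Fin L => A.act s w k := by
  induction L generalizing s w with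
  | zero => rfl
  | succ L ih =>
    rw [List.ofFn_succ, List.ofFn_succ, outWord]
    simp only [Fin.val_succ, act_succ]
    exact congrArg _ (ih _ fun k => w (k + 1))

/-- The disjoint union of the automata `A i`, reading the letters in blocks of length `L`. -/
noncomputable def blockSum [Finite X] (A : ∀ i, Automaton (S i) X) (L : ℕ) :
    Automaton (Σ i, S i) (List.Vector X L) where
  trans s v := ⟨s.1, (A s.1).sec s.2 v.1⟩
  out s := Equiv.ofBijective
    (fun v => ⟨(A s.1).outWord s.2 v.1, ((A s.1).length_outWord s.2 v.1).trans v.2⟩)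
    (Finite.injective_iff_bijective.1 fun _ _ h =>
      Subtype.ext ((A s.1).outWord_injective s.2 (congrArg Subtype.val h)))

/-- The infinite word `w`, cut into blocks of length `L`. -/
def blocks (L : ℕ) (w : ℕ → X) : ℕ → List.Vector X L :=
  fun j => ⟨List.ofFn fun k : Fin L => w (j * L + k), List.length_ofFn⟩

theorem blocks_injective {L : ℕ} (hL : 0 < L) :
    Function.Injective (blocks L : (ℕ → X) → ℕ → List.Vector X L) := by
  intro w w' h
  funext n
  have h1 := List.ofFn_injective (congrArg Subtype.val (congrFun h (n / L)))
  have h2 := congrFun h1 ⟨n % L, Nat.mod_lt n hL⟩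
  simpa only [Nat.div_add_mod'] using h2

theorem blockSum_stateAt [Finite X] (A : ∀ i, Automaton (S i) X) (L : ℕ) (i : ι) (s : S i)
    (w : ℕ → X) (j : ℕ) :
    (blockSum A L).stateAt ⟨i, s⟩ (blocks L w) j = ⟨i, (A i).stateAt s w (j * L)⟩ := by
  induction j with
  | zero => simp [stateAt]
  | succ j ih =>
    rw [stateAt, ih, Nat.succ_mul, stateAt_add, ← sec_ofFn (w := fun k => w (j * L + k))]
    rfl

theorem blockSum_act [Finite X] (A : ∀ i, Automaton (S i) X) (L : ℕ) (i : ι) (s : S i)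
    (w : ℕ → X) :
    (blockSum A L).act ⟨i, s⟩ (blocks L w) = blocks L ((A i).act s w) := by
  funext j
  apply Subtype.ext
  rw [act, blockSum_stateAt]
  refine (outWord_ofFn (A i) _ (fun k => w (j * L + k)) L).trans ?_
  simp only [blocks, act_add]

/-- For a suitable block length, the union of polynomial automata is graded by the degree. -/
theorem isGraded_blockSum [Finite X] [∀ i, Finite (S i)] (A : ∀ i, Automaton (S i) X) {m : ℤ}
    (hm : ∀ i, (A i).IsMinimized) (hp : ∀ i, (A i).IsPolynomial) (hd : ∀ i, (A i).HasDegreeLE m)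
    {L : ℕ} (hL : 0 < L) (hdvd : ∀ i, (Nat.card (S i) + 1).factorial ∣ L) :
    (blockSum A L).IsGraded fun s => (A s.1).degree s.2 where
  deg_trans_le s v := (hd s.1).degree_sec_le s.2 v.1
  lt_or_loop s v := by
    refine ((hd s.1).degree_sec_lt_or_exists (hm s.1) (hp s.1) hL (hdvd s.1) s.2 v.2).imp_right ?_
    rintro ⟨u, hu, h⟩
    exact ⟨⟨u, hu⟩, Sigma.ext rfl (heq_of_eq h)⟩
  out_eq_one s v h h0 := by
    have hid := (hd s.1).act_eq_id_of_degree_eq_zero (eq_of_heq (Sigma.ext_iff.1 h).2)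
      (List.length_pos_iff.1 (by rw [v.2]; exact hL)) h0
    obtain ⟨h1, h2⟩ := (hm s.1).eq_of_act_eq_id hid
    ext1 u
    apply Subtype.ext
    have : ∀ u : List X, (A s.1).outWord s.2 u = u := fun u => by
      induction u with
      | nil => rfl
      | cons x u ih => rw [outWord, h1, h2, ih]; rfl
    exact this u.1
  trans_eq_self s v u h h0 := by
    have hid := (hd s.1).act_eq_id_of_degree_eq_zero (eq_of_heq (Sigma.ext_iff.1 h).2)
      (List.length_pos_iff.1 (by rw [v.2]; exact hL)) h0
    exact Sigma.ext rfl (heq_of_eq ((hm s.1).sec_of_act_eq_id hid u.1))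
  deg_trans_lt s v u h h0 hne :=
    (hd s.1).degree_sec_lt (hm s.1) (hp s.1) (eq_of_heq (Sigma.ext_iff.1 h).2) h0
      (u.2.trans v.2.symm) fun h => hne (Subtype.ext h)

end Blocks

end Automaton

/-! ### Balls in Schreier graphs -/

section Balls

variable {X : Type*}

open Automaton in
/-- The products of at most `n` generators send an infinite word to at most
`|X| ^ (8 L ℓ ^ (m + 1))` infinite words, where `ℓ = ⌈log₂ n⌉ + 3`. -/
theorem exists_finset_prod_apply_mem [Fintype X] [Nontrivial X] (m : ℤ)
    (T : Set (Equiv.Perm (ℕ → X))) (hT : T.Finite) (hpol : ∀ t, t ∈ T ∨ t⁻¹ ∈ T → t ∈ Pol X m) :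
    ∃ L : ℕ, 0 < L ∧ ∀ (n : ℕ) (w : ℕ → X), ∃ F : Finset (ℕ → X),
      F.card ≤ Fintype.card X ^ (8 * L * (Nat.clog 2 n + 3) ^ (m + 1).toNat) ∧
      ∀ l : List (Equiv.Perm (ℕ → X)), l.length ≤ n → (∀ t ∈ l, t ∈ T ∨ t⁻¹ ∈ T) →
        l.prod w ∈ F := by
  classical
  let ι := {t // t ∈ T ∨ t⁻¹ ∈ T}
  have : Finite ι := (hT.union hT.inv).subset fun t ht => ht
  have := Fintype.ofFinite ι
  choose S hfin A hmin hp hd s hs using fun t : ι => hpol t.1 t.2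
  set L := ∏ t : ι, (Nat.card (S t) + 1).factorial with hLdef
  have hL : 0 < L := Finset.prod_pos fun _ _ => Nat.factorial_pos _
  have hgr := isGraded_blockSum A hmin hp hd hL fun t =>
    Finset.dvd_prod_of_mem _ (Finset.mem_univ t)
  have : Nontrivial (List.Vector X L) := by
    rw [← Fintype.one_lt_card_iff_nontrivial, card_vector]
    exact Nat.one_lt_pow hL.ne' Fintype.one_lt_card
  refine ⟨L, hL, fun n w => ?_⟩
  set N := 2 * (Nat.clog 2 n + 3) ^ (m + 1).toNat with hN
  have hNpos : 0 < N := by positivity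
  obtain ⟨F, hF, hmem⟩ := hgr.exists_finset_act N (blocks L w)
  refine ⟨F.preimage _ (blocks_injective hL).injOn, ?_, fun l hl hlT => ?_⟩
  · refine (Finset.card_le_card_of_injOn _ (fun u hu => Finset.mem_preimage.1 hu)
      (blocks_injective hL).injOn).trans (hF.trans ?_)
    rw [card_vector, ← pow_mul]
    exact (congrArg _ (by rw [hN]; ring)).le
  · obtain ⟨ρ, hρ, h⟩ : ∃ ρ : List (Σ i, S i), ρ.length = l.length ∧
        blocks L (l.prod w) = (blockSum A L).row.act ρ (blocks L w) := by
      clear hl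
      induction l with
      | nil => exact ⟨[], rfl, by simp [row_act_nil]⟩
      | cons t l ih =>
        rw [List.forall_mem_cons] at hlT
        obtain ⟨ρ, hρ, h⟩ := ih hlT.2
        refine ⟨ρ ++ [⟨⟨t, hlT.1⟩, s ⟨t, hlT.1⟩⟩], by simp [hρ], ?_⟩
        rw [row_act_append, ← h, row_act_singleton, blockSum_act, hs]
        rfl
    rw [Finset.mem_preimage, h]
    exact hmem (N - 1) ρ (by omega)
      (hgr.changesLE n (fun s _ => (hd s.1).degree_le s.2) (hρ.trans_le hl))

/-- The elements of a finite subset of the group generated by `T`, and their inverses, are products of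
bounded length of elements of `T` and their inverses. -/
theorem exists_length_bound {M : Type*} [Group M] {T T' : Set M} (hT' : T'.Finite)
    (h : T' ⊆ Subgroup.closure T) :
    ∃ k : ℕ, 0 < k ∧ ∀ t, t ∈ T' ∨ t⁻¹ ∈ T' →
      ∃ l : List M, l.length ≤ k ∧ (∀ x ∈ l, x ∈ T ∨ x⁻¹ ∈ T) ∧ l.prod = t := by
  have hfin : {t | t ∈ T' ∨ t⁻¹ ∈ T'}.Finite := (hT'.union hT'.inv).subset fun t ht => ht
  have hex : ∀ t, t ∈ T' ∨ t⁻¹ ∈ T' → ∃ l : List M, (∀ x ∈ l, x ∈ T ∨ x⁻¹ ∈ T) ∧ l.prod = t :=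
    fun t ht => by
      have h1 : t ∈ (Subgroup.closure T).toSubmonoid :=
        ht.elim (fun ht => h ht) fun ht => by simpa using inv_mem (h ht)
      rw [Subgroup.closure_toSubmonoid] at h1
      exact Submonoid.exists_list_of_mem_closure h1
  choose! f hf using hex
  obtain ⟨k, hk⟩ := (hfin.image fun t => (f t).length).bddAbove
  exact ⟨k + 1, k.succ_pos, fun t ht =>
    ⟨f t, (hk ⟨t, ht, rfl⟩).trans k.le_succ, hf t ht⟩⟩

/-- The vertices of a ball in the Schreier graph for the generating set `T'` are images of the
center under products of bounded length of elements of `T`. -/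
theorem exists_prod_of_mem_graphBall {G : Subgroup (Equiv.Perm (ℕ → X))}
    {T T' : Set (Equiv.Perm (ℕ → X))} {k : ℕ} (hk : ∀ t, t ∈ T' ∨ t⁻¹ ∈ T' →
      ∃ l : List (Equiv.Perm (ℕ → X)), l.length ≤ k ∧ (∀ x ∈ l, x ∈ T ∨ x⁻¹ ∈ T) ∧ l.prod = t)
    {w : ℕ → X} {u v : MulAction.orbit G w} {n : ℕ}
    (hu : u ∈ graphBall (orbitalSchreierGraph G T' w) v n) :
    ∃ l : List (Equiv.Perm (ℕ → X)), l.length ≤ k * n ∧ (∀ x ∈ l, x ∈ T ∨ x⁻¹ ∈ T) ∧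
      l.prod (v : ℕ → X) = u := by
  have hu' : (orbitalSchreierGraph G T' w).edist v u ≤ n := hu
  obtain ⟨p, hp⟩ := SimpleGraph.exists_walk_of_edist_ne_top
    (ne_top_of_le_ne_top (ENat.natCast_ne_top n) hu')
  have hpn : p.length ≤ n := by rw [← hp] at hu'; exact_mod_cast hu'
  clear hp hu hu'
  revert hpn
  induction p generalizing n with
  | nil => exact fun _ => ⟨[], by simp, by simp, by simp⟩
  | cons hadj p ih =>
    intro hpn
    rw [SimpleGraph.Walk.length_cons] at hpn
    obtain ⟨n, rfl⟩ : ∃ n', n = n' + 1 := ⟨n - 1, by omega⟩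
    obtain ⟨-, t, ht, htv⟩ := hadj
    obtain ⟨l₁, hl₁, hT₁, rfl⟩ := hk t ht
    obtain ⟨l₂, hl₂, hT₂, h⟩ := ih (n := n) (by omega)
    refine ⟨l₂ ++ l₁, by rw [List.length_append, mul_add]; omega, fun x hx => ?_, ?_⟩
    · exact (List.mem_append.1 hx).elim (hT₂ x) (hT₁ x)
    · rw [List.prod_append, Equiv.Perm.mul_apply, htv, h]

theorem graphBall_zero {V : Type*} (Γ : SimpleGraph V) (v : V) : graphBall Γ v 0 = {v} := by
  ext u
  simp [graphBall, eq_comm (a := v)]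

end Balls

/-! ### Subexponential growth -/

section Growth

theorem logTwo_of_one_lt {n : ℕ} (hn : 1 < n) : logTwo n = Real.logb 2 n :=
  if_neg (by omega)

theorem one_le_logTwo (n : ℕ) : 1 ≤ logTwo n := by
  rcases Nat.lt_or_ge 1 n with hn | hn
  · rw [logTwo_of_one_lt hn, Real.le_logb_iff_rpow_le one_lt_two (by positivity)]
    simpa using (by exact_mod_cast hn : (2 : ℝ) ≤ n)
  · rw [logTwo, if_pos hn]

theorem clog_add_three_le_logTwo {n : ℕ} (hn : 0 < n) :
    (Nat.clog 2 n + 3 : ℝ) ≤ logTwo (16 * n) := by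
  have h0 : (0 : ℝ) < n := by exact_mod_cast hn
  have h1 : (1 : ℝ) ≤ n := by exact_mod_cast hn
  have h2 : (Nat.clog 2 n : ℝ) < Real.logb 2 n + 1 := by
    rw [← Real.natCeil_logb_natCast]
    exact_mod_cast Nat.ceil_lt_add_one (Real.logb_nonneg one_lt_two h1)
  rw [logTwo_of_one_lt (by omega), Nat.cast_mul, Real.logb_mul (by norm_num) h0.ne']
  have h3 : Real.logb 2 ((16 : ℕ) : ℝ) = 4 := by
    rw [show ((16 : ℕ) : ℝ) = 2 ^ (4 : ℝ) by norm_num]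
    exact Real.logb_rpow (by norm_num) (by norm_num)
  linarith

open Filter in
theorem eventually_mul_logTwo_pow_le (c : ℝ) {ε : ℝ} (hε : 0 < ε) {E : ℕ} (hE : 0 < E) (r : ℕ) :
    ∀ᶠ n : ℕ in atTop, c * logTwo (E * n) ^ r ≤ ε * n := by
  have hE' : (0 : ℝ) < E := by exact_mod_cast hE
  have hlog : (0 : ℝ) < Real.log 2 := Real.log_pos one_lt_two
  have ht : Tendsto (fun n : ℕ => (E : ℝ) * n) atTop atTop :=
    tendsto_natCast_atTop_atTop.const_mul_atTop hE'
  set δ := ε * Real.log 2 ^ r / (E * (|c| + 1)) with hδ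
  have hδ0 : 0 < δ := by positivity
  filter_upwards [ht.eventually ((Real.isLittleO_pow_log_id_atTop (n := r)).def hδ0),
    eventually_gt_atTop 1] with n hn hn1
  have hn0 : (0 : ℝ) < n := by positivity
  have hEn : 1 < E * n := lt_of_lt_of_le hn1 (Nat.le_mul_of_pos_left n hE)
  have hnn : 0 ≤ logTwo (E * n) ^ r := pow_nonneg (zero_le_one.trans (one_le_logTwo _)) r
  have h1 : logTwo (E * n) ^ r * Real.log 2 ^ r = Real.log (E * n) ^ r := by
    rw [logTwo_of_one_lt hEn, ← mul_pow, Real.logb, div_mul_cancel₀ _ hlog.ne', Nat.cast_mul]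
  rw [Real.norm_eq_abs, Real.norm_eq_abs, id, abs_of_pos (mul_pos hE' hn0), ← h1] at hn
  replace hn := (le_abs_self _).trans hn
  have h2 : δ * (E * n) = ε * n / (|c| + 1) * Real.log 2 ^ r := by
    rw [hδ]; field_simp
  rw [h2] at hn
  have h3 := le_of_mul_le_mul_right hn (by positivity)
  rw [le_div_iff₀ (by positivity)] at h3
  calc c * logTwo (E * n) ^ r ≤ logTwo (E * n) ^ r * (|c| + 1) := by
        rw [mul_comm]
        exact mul_le_mul_of_nonneg_left ((le_abs_self c).trans (by linarith)) hnn
    _ ≤ ε * n := h3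

open Filter in
theorem isSubexponential_of_le {f : ℕ → ℕ} {q C : ℝ} (hq : 0 < q) {D r : ℕ} (hD : 0 < D)
    (h0 : f 0 ≤ 1) (hf : ∀ n, (f n : ℝ) ≤ q ^ (C * logTwo (D * n) ^ r)) :
    IsSubexponential fun n => (f n : ℝ) := by
  have hexp : ∀ n, (f n : ℝ) ≤ Real.exp (Real.log q * C * logTwo (D * n) ^ r) := fun n => by
    rw [mul_assoc, ← Real.rpow_def_of_pos hq]
    exact hf n
  intro a ha
  have ha0 : 0 < a := zero_lt_one.trans ha
  have hla : 0 < Real.log a := Real.log_pos ha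
  have hpow : ∀ n : ℕ, a ^ n = Real.exp (Real.log a * n) := fun n => by
    rw [← Real.rpow_def_of_pos ha0, Real.rpow_natCast]
  refine ⟨?_, ?_⟩
  · obtain ⟨N, hN⟩ := eventually_atTop.1 (eventually_mul_logTwo_pow_le (Real.log q * C) hla hD r)
    obtain ⟨D₀, hD₀⟩ := pow_unbounded_of_one_lt (∑ n ∈ Finset.range N, (f n : ℝ)) ha
    refine ⟨D₀ + 1, D₀.succ_pos, fun n => ?_⟩
    rcases Nat.eq_zero_or_pos n with rfl | hn
    · simpa using h0
    rcases Nat.lt_or_ge n N with hnN | hnN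
    · calc (f n : ℝ) ≤ ∑ n ∈ Finset.range N, (f n : ℝ) :=
            Finset.single_le_sum (f := fun n => (f n : ℝ)) (fun _ _ => Nat.cast_nonneg _)
              (Finset.mem_range.2 hnN)
        _ ≤ a ^ D₀ := hD₀.le
        _ ≤ a ^ ((D₀ + 1) * n) := pow_le_pow_right₀ ha.le (by nlinarith)
    · calc (f n : ℝ) ≤ a ^ n := (hexp n).trans (by rw [hpow]; exact Real.exp_le_exp.2 (hN n hnN))
        _ ≤ a ^ ((D₀ + 1) * n) := pow_le_pow_right₀ ha.le (Nat.le_mul_of_pos_left n D₀.succ_pos)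
  · rintro ⟨-, D', hD', h⟩
    obtain ⟨n, hn, hn0⟩ := ((eventually_mul_logTwo_pow_le (Real.log q * C) (half_pos hla)
      (Nat.mul_pos hD hD') r).and (eventually_gt_atTop 0)).exists
    have h1 := (h n).trans (hexp (D' * n))
    simp only [hpow] at h1
    rw [Real.exp_le_exp, ← mul_assoc D] at h1
    have h2 : 0 < Real.log a * n := mul_pos hla (by exact_mod_cast hn0)
    linarith

end Growth

theorem theorem2 {X : Type*} [Finite X] [Nontrivial X] (m : ℤ) (hm : -1 ≤ m)
    (G : Subgroup (Equiv.Perm (ℕ → X))) (hfg : G.FG)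
    (hG : (G : Set (Equiv.Perm (ℕ → X))) ⊆ Pol X m) :
    ∃ C : ℝ, 0 < C ∧
      ∀ T : Set (Equiv.Perm (ℕ → X)), T.Finite → Subgroup.closure T = G →
        (∃ D : ℕ, 0 < D ∧ ∀ (w : ℕ → X) (v : MulAction.orbit G w) (n : ℕ),
          (graphBall (orbitalSchreierGraph G T w) v n).Finite ∧
          (growthFun (orbitalSchreierGraph G T w) v n : ℝ) ≤
            (Nat.card X : ℝ) ^ (C * logTwo (D * n) ^ (m + 1))) ∧
        ∀ (w : ℕ → X) (v : MulAction.orbit G w),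
          IsSubexponential (fun n => (growthFun (orbitalSchreierGraph G T w) v n : ℝ)) := by
  have := Fintype.ofFinite X
  obtain ⟨T₀, hT₀⟩ := hfg
  obtain ⟨r, hr⟩ : ∃ r : ℕ, m + 1 = r := ⟨(m + 1).toNat, by omega⟩
  -- `C` is computed from one generating set; other ones only rescale the argument
  obtain ⟨L, hL, hbound⟩ := exists_finset_prod_apply_mem m (T₀ : Set (Equiv.Perm (ℕ → X)))
    T₀.finite_toSet fun t ht => hG (by
      rw [← hT₀]
      exact ht.elim (fun h => Subgroup.subset_closure h)
        fun h => by simpa using inv_mem (Subgroup.subset_closure h))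
  rw [hr] at hbound ⊢
  simp only [Int.toNat_natCast] at hbound
  simp only [zpow_natCast]
  have hq : (1 : ℝ) ≤ Nat.card X := by exact_mod_cast Nat.card_pos
  refine ⟨8 * L, by positivity, fun T hT hTG => ?_⟩
  obtain ⟨k, hk, hkT⟩ := exists_length_bound (T := (T₀ : Set (Equiv.Perm (ℕ → X)))) hT
    (by rw [hT₀, ← hTG]; exact Subgroup.subset_closure)
  have main : ∀ (w : ℕ → X) (v : MulAction.orbit G w) (n : ℕ),
      (graphBall (orbitalSchreierGraph G T w) v n).Finite ∧
      (growthFun (orbitalSchreierGraph G T w) v n : ℝ) ≤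
        (Nat.card X : ℝ) ^ (8 * L * logTwo (16 * k * n) ^ r) := by
    intro w v n
    obtain ⟨F, hF, hmem⟩ := hbound (k * n) v
    have hmaps : ∀ u ∈ graphBall (orbitalSchreierGraph G T w) v n, (u : ℕ → X) ∈ (F : Set _) := by
      intro u hu
      obtain ⟨l, hl, hlT, h⟩ := exists_prod_of_mem_graphBall hkT hu
      rw [← h]
      exact hmem l hl hlT
    refine ⟨Set.Finite.of_injOn hmaps Subtype.val_injective.injOn F.finite_toSet, ?_⟩
    have hlog := one_le_logTwo (16 * k * n)
    rcases Nat.eq_zero_or_pos n with rfl | hn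
    · rw [growthFun, graphBall_zero, Set.ncard_singleton, Nat.cast_one]
      exact Real.one_le_rpow hq (by positivity)
    · have h1 : growthFun (orbitalSchreierGraph G T w) v n ≤ F.card := by
        rw [growthFun, ← Set.ncard_coe_finset]
        exact Set.ncard_le_ncard_of_injOn _ hmaps Subtype.val_injective.injOn F.finite_toSet
      have h2 := clog_add_three_le_logTwo (Nat.mul_pos hk hn)
      rw [← mul_assoc] at h2
      calc (growthFun (orbitalSchreierGraph G T w) v n : ℝ)
          ≤ (Nat.card X : ℝ) ^ (8 * L * (Nat.clog 2 (k * n) + 3) ^ r) := by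
            rw [Nat.card_eq_fintype_card]
            exact_mod_cast h1.trans hF
        _ = (Nat.card X : ℝ) ^ (8 * L * (Nat.clog 2 (k * n) + 3 : ℝ) ^ r) := by
            rw [← Real.rpow_natCast]
            push_cast
            rfl
        _ ≤ (Nat.card X : ℝ) ^ (8 * L * logTwo (16 * k * n) ^ r) := by
            refine Real.rpow_le_rpow_of_exponent_le hq ?_
            gcongr
  exact ⟨⟨16 * k, by positivity, main⟩, fun w v =>
    isSubexponential_of_le (zero_lt_one.trans_le hq) (D := 16 * k) (by positivity)
      (by rw [growthFun, graphBall_zero, Set.ncard_singleton]) fun n => (main w v n).2⟩
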